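/- Let $H$ be a real or complex Hilbert space and $A$ a closed, densely defined linear operator in $H$. Put $T=A^*A$ and $T_a=T+aI$ for $a>0$, and let $E_s$ be the resolution of the identity of the selfadjoint operator $T$. Fix $p\in(0,1)$ and $k_p>0$ and let $$\mathcal K=\Big\{y\in H:\int_0^\infty s^{-2p}\,d(E_sy,y)\le k_p^2\Big\}$$ (the integrand being $+\infty$ at $s=0$). For $a>0$ the operator $T_a^{-1}A^*$ is closable and its closure, again denoted $T_a^{-1}A^*$, is defined on all of $H$. For $f_\delta\in H$ and $\delta>0$ put $S_\delta(f_\delta)=\{v\in\mathcal K\cap D(A):\|Av-f_\delta\|\le\delta\}$; the supremum over an empty set below is $0$. (i) If $a(\delta)>0$ for $\delta>0$, $\lim_{\delta\to0}\delta/a(\delta)^{1/2}=0$ and $\lim_{\delta\to0}a(\delta)=0$, then $R_\delta=T_{a(\delta)}^{-1}A^*$ is a regularizer in the following uniform sense: there is a function $\eta$, with $\eta(\delta)\to0$ as $\delta\to0$, such that $\sup_{v\in S_\delta(f_\delta)}\|R_\delta f_\delta-v\|\le\eta(\delta)$ for all $\delta>0$ and all $f_\delta\in H$. (ii) Let $$c_p=p^p(1-p)^{1-p},\qquad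 b_p=(4pc_pk_p)^{-\frac2{2p+1}},\qquad C_p=\frac1{2\sqrt{b_p}}+c_pk_pb_p^p .$$ If $a(\delta)=b_p\delta^{\frac2{2p+1}}$, then for all $\delta>0$ and $f_\delta\in H$ $$\sup_{y\in\mathcal K\cap D(A),\ \|Ay-f_\delta\|\le\delta}\|R_\delta f_\delta-y\|\le C_p\,\delta^{\frac{2p}{2p+1}} .$$ (iii) For all $\delta>0$, $a>0$ and $f_\delta\in H$, $$\sup_{y\in\mathcal K\cap D(A),\ \|Ay-f_\delta\|\le\delta}\|T_a^{-1}A^*f_\delta-y\|\le\frac{\delta}{2\sqrt a}+c_pk_pa^p,$$ and the choice $a=a(\delta)=b_p\delta^{\frac2{2p+1}}$ minimises the right-hand side over $a>0$. -/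

import Mathlib

open Set Filter Topology MeasureTheory
open scoped ENNReal

noncomputable section

namespace IllPosed

variable {𝕜 H : Type*} [RCLike 𝕜] [NormedAddCommGroup H] [InnerProductSpace 𝕜 H]

/-! ### Unbounded operators -/

/-- The product `g f` of two unbounded operators, on its maximal domain
`{x ∈ D(f) : f x ∈ D(g)}`. -/
def opMul (g f : H →ₗ.[𝕜] H) : H →ₗ.[𝕜] H :=
  g.comp (f.domRestrict ((g.domain.comap f.toFun).map f.domain.subtype)) (by
    rintro ⟨x, hx, hx'⟩
    obtain ⟨z, hz, rfl⟩ := hx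
    have hz' : f z ∈ g.domain := hz
    exact hz')

theorem mem_opMul_domain {g f : H →ₗ.[𝕜] H} {x : H} :
    x ∈ (opMul g f).domain ↔ ∃ hx : x ∈ f.domain, f ⟨x, hx⟩ ∈ g.domain := by
  constructor
  · rintro ⟨⟨z, hz, rfl⟩, -⟩
    exact ⟨z.2, hz⟩
  · rintro ⟨hx, hg⟩
    exact ⟨⟨⟨x, hx⟩, hg, rfl⟩, hx⟩

theorem opMul_apply {g f : H →ₗ.[𝕜] H} {x : H} (h : x ∈ (opMul g f).domain)
    (hx : x ∈ f.domain) (hg : f ⟨x, hx⟩ ∈ g.domain) :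
    opMul g f ⟨x, h⟩ = g ⟨f ⟨x, hx⟩, hg⟩ := rfl

variable [CompleteSpace H]

/-- The operator `T = A* A`. -/
def opT (A : H →ₗ.[𝕜] H) : H →ₗ.[𝕜] H := opMul A.adjoint A

/-- The operator `T_a = T + a I`, with domain `D(T)`. -/
def opTa (A : H →ₗ.[𝕜] H) (a : ℝ) : H →ₗ.[𝕜] H :=
  ((a : 𝕜) • (LinearMap.id : H →ₗ[𝕜] H)) +ᵥ opT A

/-- The densely defined operator `T_a⁻¹ A*`. -/
def preRegOp (A : H →ₗ.[𝕜] H) (a : ℝ) : H →ₗ.[𝕜] H :=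
  opMul (opTa A a).inverse A.adjoint

/-- The regularizing operator: the closure of `T_a⁻¹ A*`. -/
def regOp (A : H →ₗ.[𝕜] H) (a : ℝ) : H →ₗ.[𝕜] H := (preRegOp A a).closure

/-! ### Resolutions of the identity -/

variable (𝕜 H) in
/-- A resolution of the identity: a right-continuous increasing family of orthogonal projections
`E_s`, `s ∈ ℝ`, which tends strongly to `0` as `s → -∞` and to `I` as `s → ∞`. -/
structure ResolutionOfIdentity where
  proj : ℝ → H →L[𝕜] H
  isStarProjection : ∀ s, IsStarProjection (proj s)
  mul_of_le : ∀ s t, s ≤ t → proj s * proj t = proj s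
  right_continuous : ∀ s x, Tendsto (fun t => proj t x) (𝓝[>] s) (𝓝 (proj s x))
  tendsto_atBot : ∀ x, Tendsto (fun t => proj t x) atBot (𝓝 0)
  tendsto_atTop : ∀ x, Tendsto (fun t => proj t x) atTop (𝓝 x)

namespace ResolutionOfIdentity

variable (E : ResolutionOfIdentity 𝕜 H)

/-- The distribution function `s ↦ (E_s y, y)`. -/
def distrib (y : H) (s : ℝ) : ℝ := RCLike.re (inner 𝕜 (E.proj s y) y)

theorem distrib_eq_norm_sq (y : H) (s : ℝ) : E.distrib y s = ‖E.proj s y‖ ^ 2 := by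
  have h1 : ContinuousLinearMap.adjoint (E.proj s) = E.proj s :=
    (E.isStarProjection s).isSelfAdjoint
  have h2 : E.proj s (E.proj s y) = E.proj s y :=
    congrArg (fun B : H →L[𝕜] H => B y) (E.isStarProjection s).isIdempotentElem
  have h3 : inner 𝕜 (E.proj s y) y = inner 𝕜 (E.proj s y) (E.proj s y) := by
    rw [← ContinuousLinearMap.adjoint_inner_left, h1, h2]
  rw [distrib, h3, inner_self_eq_norm_sq]

theorem distrib_mono (y : H) : Monotone (E.distrib y) := by
  intro s t hst
  rw [E.distrib_eq_norm_sq, E.distrib_eq_norm_sq]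
  have h : E.proj s y = E.proj s (E.proj t y) :=
    (congrArg (fun B : H →L[𝕜] H => B y) (E.mul_of_le s t hst)).symm
  rw [h]
  gcongr
  have h1 : ContinuousLinearMap.adjoint (E.proj s) = E.proj s :=
    (E.isStarProjection s).isSelfAdjoint
  have h2 : ∀ z, E.proj s (E.proj s z) = E.proj s z := fun z =>
    congrArg (fun B : H →L[𝕜] H => B z) (E.isStarProjection s).isIdempotentElem
  have h3 : ∀ z, ‖E.proj s z‖ ^ 2 ≤ ‖E.proj s z‖ * ‖z‖ := by
    intro z
    have h4 : inner 𝕜 (E.proj s z) z = inner 𝕜 (E.proj s z) (E.proj s z) := by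
      rw [← ContinuousLinearMap.adjoint_inner_left, h1, h2]
    rw [← inner_self_eq_norm_sq (𝕜 := 𝕜), ← h4]
    exact re_inner_le_norm _ _
  have h5 := h3 (E.proj t y)
  by_contra! hlt
  nlinarith [norm_nonneg (E.proj t y), norm_nonneg (E.proj s (E.proj t y))]

theorem distrib_right_continuous (y : H) (s : ℝ) :
    ContinuousWithinAt (E.distrib y) (Ici s) s := by
  rw [← continuousWithinAt_Ioi_iff_Ici, ContinuousWithinAt]
  rw [funext (E.distrib_eq_norm_sq y)]
  exact ((E.right_continuous s y).norm).pow 2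

/-- The Lebesgue-Stieltjes measure `d(E_s y, y)` on the real line. -/
def measure (y : H) : Measure ℝ :=
  StieltjesFunction.measure
    { toFun := E.distrib y
      mono' := E.distrib_mono y
      right_continuous' := E.distrib_right_continuous y }

/-- `E` is the resolution of the identity of the (selfadjoint) operator `T`, i.e. `T = ∫ s dE_s`:
`T` is symmetric, `D(T) = {x : ∫ s² d(E_s x, x) < ∞}`, and `(T x, x) = ∫ s d(E_s x, x)` for
`x ∈ D(T)` (which determines `(T x, z)` by polarization). -/
structure IsResolutionOf (T : H →ₗ.[𝕜] H) : Prop where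
  symmetric : T.IsFormalAdjoint T
  mem_domain_iff : ∀ x : H, x ∈ T.domain ↔ ∫⁻ s, ENNReal.ofReal (s ^ 2) ∂(E.measure x) < ∞
  inner_eq : ∀ x : T.domain,
    inner 𝕜 (T x) (x : H) = ((∫ s, s ∂(E.measure (x : H)) : ℝ) : 𝕜)

end ResolutionOfIdentity

/-- The set `𝒦 = {y : ∫₀^∞ s^(-2p) d(E_s y, y) ≤ k²}`, where `E` is the (unique) resolution of the
identity of `T = A* A`. The integrand takes the value `∞` at `s = 0`, so that elements of `𝒦` are
orthogonal to the null space of `A`. -/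
def sourceSet (A : H →ₗ.[𝕜] H) (p k : ℝ) : Set H :=
  {y | ∃ E : ResolutionOfIdentity 𝕜 H, E.IsResolutionOf (opT A) ∧
    ∫⁻ s in Ici (0 : ℝ), ENNReal.ofReal s ^ (-2 * p) ∂(E.measure y) ≤ ENNReal.ofReal (k ^ 2)}

/-! ### Regularizers -/

/-- `S_δ = {v ∈ 𝒦 : ‖A v - f‖ ≤ δ}`; its elements lie in the domain of `A`. -/
def admissible (A : H →ₗ.[𝕜] H) (K : Set H) (f : H) (δ : ℝ) : Set H :=
  {v | v ∈ K ∧ ∃ hv : v ∈ A.domain, ‖A ⟨v, hv⟩ - f‖ ≤ δ}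

/-- The worst error `sup {‖u - v‖ : v ∈ S}` of an approximation `u`, in `[0, ∞]`. -/
def worstError (S : Set H) (u : H) : ℝ≥0∞ := ⨆ v ∈ S, ENNReal.ofReal ‖u - v‖

/-- The family `R δ`, `δ > 0`, is a regularizer for `A u = f` in the uniform sense: it is
defined on all data and
`sup {‖R δ f - v‖ : v ∈ 𝒦, ‖A v - f‖ ≤ δ} ≤ η δ → 0` as `δ → 0`, for all data `f`. -/
def IsUniformRegularizer (A : H →ₗ.[𝕜] H) (K : Set H) (R : ℝ → H →ₗ.[𝕜] H) : Prop :=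
  ∃ η : ℝ → ℝ, Tendsto η (𝓝[>] 0) (𝓝 0) ∧
    ∀ δ : ℝ, 0 < δ → ∀ f : H, ∃ hf : f ∈ (R δ).domain,
      worstError (admissible A K f δ) (R δ ⟨f, hf⟩) ≤ ENNReal.ofReal (η δ)

/-! ### Constants -/

/-- `c_p = p^p (1-p)^(1-p)`. -/
def cConst (p : ℝ) : ℝ := p ^ p * (1 - p) ^ (1 - p)

/-- `b_p = (4 p c_p k_p)^(-2/(2p+1))`. -/
def bConst (p k : ℝ) : ℝ := (4 * p * cConst p * k) ^ (-(2 / (2 * p + 1)))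

/-- `C_p = 1/(2 √b_p) + c_p k_p b_p^p`. -/
def CConst (p k : ℝ) : ℝ := 1 / (2 * √(bConst p k)) + cConst p * k * bConst p k ^ p

/-- The choice `a(δ) = b_p δ^(2/(2p+1))`. -/
def aOpt (p k δ : ℝ) : ℝ := bConst p k * δ ^ (2 / (2 * p + 1))

/-- The error bound `δ/(2√a) + c_p k_p a^p`. -/
def errorBound (p k δ a : ℝ) : ℝ := δ / (2 * √a) + cConst p * k * a ^ p

end IllPosed

end

noncomputable section

namespace IllPosed

/-! ### Constants -/

/-! The closure of `T_a⁻¹ A*` is a bounded operator `B` sending `f` to the Tikhonov minimiser. It is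
built by orthogonal projection onto a rescaled graph of `A` (`exists_isTikhonov`) and identified
with the closure because `D(A*)` is dense (`IsTikhonov.mem_graph_regOp`).

For admissible `v`, `B f - v = B (f - A v) - w` with `w = v - B A v`. The data term is at most
`δ/(2√a)`, since `‖B‖ ≤ 1/(2√a)`. The bias satisfies `(T + a) w = a v`, so spectrally it is
`a/(s+a)` applied to `v`, and `a/(s+a) ≤ c_p a^p s^(-p)` by weighted AM-GM; the source condition
then gives `‖w‖ ≤ c_p k a^p`.

No functional calculus is used for the bias. The quadratic form of `T` splits along the projections
`E_t - E_s`, which gives the estimate on each interval with its left endpoint in place of `s`;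
summing over the intervals `(r^n, r^(n+1)]` and letting `r → 1` gives the sharp constant
(`IsResolutionOf.norm_le_of_lintegral_le`).

All the error statements then follow from the real function `errorBound` and its minimiser. -/

theorem cConst_pos {p : ℝ} (hp0 : 0 < p) (hp1 : p < 1) : 0 < cConst p := by
  have : 0 < 1 - p := by linarith
  unfold cConst
  positivity

/-- Weighted AM-GM with weights `p`, `1 - p` applied to `s/p` and `a/(1-p)`; dividing by the weights
is what produces `c_p`. -/
theorem rpow_mul_rpow_le_cConst {p s a : ℝ} (hp0 : 0 < p) (hp1 : p < 1) (hs : 0 < s)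
    (ha : 0 < a) : s ^ p * a ^ (1 - p) ≤ cConst p * (s + a) := by
  have hq : 0 < 1 - p := by linarith
  have h := Real.geom_mean_le_arith_mean2_weighted hp0.le hq.le (div_pos hs hp0).le
    (div_pos ha hq).le (by ring)
  rw [mul_div_cancel₀ _ hp0.ne', mul_div_cancel₀ _ hq.ne', Real.div_rpow hs.le hp0.le,
    Real.div_rpow ha.le hq.le, div_mul_div_comm, div_le_iff₀ (by positivity)] at h
  rw [cConst, mul_comm _ (s + a)]
  exact h

theorem div_add_le_cConst {p s a : ℝ} (hp0 : 0 < p) (hp1 : p < 1) (hs : 0 < s) (ha : 0 < a) :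
    a / (s + a) ≤ cConst p * a ^ p * s ^ (-p) := by
  have h := rpow_mul_rpow_le_cConst hp0 hp1 hs ha
  have hsp : 0 < s ^ p := by positivity
  have hap : 0 < a ^ p := by positivity
  rw [Real.rpow_neg hs.le, ← div_eq_mul_inv, div_le_div_iff₀ (by positivity) hsp]
  have h1 : a ^ p * a ^ (1 - p) = a := by
    rw [← Real.rpow_add ha]; simp
  calc a * s ^ p = a ^ p * (s ^ p * a ^ (1 - p)) := by
        conv_lhs => rw [← h1]
        ring
    _ ≤ a ^ p * (cConst p * (s + a)) := by gcongr
    _ = cConst p * a ^ p * (s + a) := by ring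


theorem bConst_pos {p k : ℝ} (hp0 : 0 < p) (hp1 : p < 1) (hk : 0 < k) : 0 < bConst p k := by
  have := cConst_pos hp0 hp1
  unfold bConst
  positivity

theorem aOpt_pos {p k δ : ℝ} (hp0 : 0 < p) (hp1 : p < 1) (hk : 0 < k) (hδ : 0 < δ) :
    0 < aOpt p k δ := by
  have := bConst_pos hp0 hp1 hk
  unfold aOpt
  positivity

theorem errorBound_aOpt {p k δ : ℝ} (hp0 : 0 < p) (hp1 : p < 1) (hk : 0 < k) (hδ : 0 < δ) :
    errorBound p k δ (aOpt p k δ) = CConst p k * δ ^ (2 * p / (2 * p + 1)) := by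
  have hb := bConst_pos hp0 hp1 hk
  have h1 : (δ ^ (2 / (2 * p + 1))) ^ p = δ ^ (2 * p / (2 * p + 1)) := by
    rw [← Real.rpow_mul hδ.le]; congr 1; ring
  have h2 : √(δ ^ (2 / (2 * p + 1))) * δ ^ (2 * p / (2 * p + 1)) = δ := by
    rw [Real.sqrt_eq_rpow, ← Real.rpow_mul hδ.le, ← Real.rpow_add hδ]
    rw [show 2 / (2 * p + 1) * (1 / 2) + 2 * p / (2 * p + 1) = 1 by field_simp; ring, Real.rpow_one]
  have hd : 0 < √(δ ^ (2 / (2 * p + 1))) := by positivity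
  have hsb : 0 < √(bConst p k) := by positivity
  rw [errorBound, CConst, aOpt, Real.sqrt_mul hb.le, Real.mul_rpow hb.le (by positivity), h1]
  have h3 : δ / (2 * (√(bConst p k) * √(δ ^ (2 / (2 * p + 1))))) =
      1 / (2 * √(bConst p k)) * δ ^ (2 * p / (2 * p + 1)) := by
    rw [div_eq_iff (by positivity)]
    field_simp
    linarith
  rw [h3]
  ring

/-- This is the vanishing of the `a`-derivative of the error bound, cleared of denominators. -/
theorem stationarity_aOpt {p k δ : ℝ} (hp0 : 0 < p) (hp1 : p < 1) (hk : 0 < k) (hδ : 0 < δ) :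
    4 * p * (cConst p * k * aOpt p k δ ^ p) * √(aOpt p k δ) = δ := by
  have hc := cConst_pos hp0 hp1
  have ha := aOpt_pos hp0 hp1 hk hδ
  set g := 4 * p * cConst p * k with hg
  have hg0 : 0 < g := by positivity
  have h1 : aOpt p k δ ^ p * √(aOpt p k δ) = g⁻¹ * δ := by
    rw [Real.sqrt_eq_rpow, ← Real.rpow_add ha, aOpt, bConst, ← hg,
      Real.mul_rpow (by positivity) (by positivity), ← Real.rpow_mul hg0.le, ← Real.rpow_mul hδ.le]
    rw [show -(2 / (2 * p + 1)) * (p + 1 / 2) = -1 by field_simp,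
      show 2 / (2 * p + 1) * (p + 1 / 2) = 1 by field_simp, Real.rpow_one, Real.rpow_neg_one]
  calc _ = g * (aOpt p k δ ^ p * √(aOpt p k δ)) := by rw [hg]; ring
    _ = δ := by rw [h1, mul_inv_cancel_left₀ hg0.ne']

/-- In the variable `t = log (a/m)`, with `m` the stationary point, the bound becomes `K (2p
e^(-t/2) + e^(pt))`. Bounding both exponentials below by their tangents at `t = 0` suffices, because
the slopes cancel. -/
theorem errorBound_aOpt_le {p k δ a : ℝ} (hp0 : 0 < p) (hp1 : p < 1) (hk : 0 < k) (hδ : 0 < δ)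
    (ha : 0 < a) : errorBound p k δ (aOpt p k δ) ≤ errorBound p k δ a := by
  have hc := cConst_pos hp0 hp1
  have hm := aOpt_pos hp0 hp1 hk hδ
  have hst := stationarity_aOpt hp0 hp1 hk hδ
  set m := aOpt p k δ with hmdef
  obtain ⟨t, ht⟩ : ∃ t, a = m * Real.exp t :=
    ⟨Real.log (a / m), by rw [Real.exp_log (div_pos ha hm)]; field_simp⟩
  have hsm : 0 < √m := Real.sqrt_pos.2 hm
  set K := cConst p * k * m ^ p with hK
  have hK0 : 0 < K := by positivity
  have e1 : δ / (2 * √m) = 2 * p * K := by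
    rw [div_eq_iff (by positivity)]; linarith
  have e2 : δ / (2 * √a) = 2 * p * K * Real.exp (-(t / 2)) := by
    have : √(Real.exp t) = Real.exp (t / 2) := (Real.exp_half t).symm
    rw [ht, Real.sqrt_mul hm.le, this, Real.exp_neg, ← e1]
    field_simp
  have e3 : cConst p * k * a ^ p = K * Real.exp (p * t) := by
    rw [ht, Real.mul_rpow hm.le (Real.exp_pos t).le, ← Real.exp_mul, hK, mul_comm t p]
    ring
  rw [errorBound, errorBound, e1, e2, e3, ← hK]
  have h1 := Real.add_one_le_exp (-(t / 2))
  have h2 := Real.add_one_le_exp (p * t)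
  have h3 : 2 * p * K * (-(t / 2) + 1) ≤ 2 * p * K * Real.exp (-(t / 2)) := by gcongr
  have h4 : K * (p * t + 1) ≤ K * Real.exp (p * t) := by gcongr
  linarith

theorem tendsto_errorBound {p k : ℝ} (hp0 : 0 < p) {a : ℝ → ℝ}
    (h1 : Tendsto (fun δ => δ / a δ ^ (1 / 2 : ℝ)) (𝓝[>] 0) (𝓝 0))
    (h2 : Tendsto a (𝓝[>] 0) (𝓝 0)) :
    Tendsto (fun δ => errorBound p k δ (a δ)) (𝓝[>] 0) (𝓝 0) := by
  have h3 : Tendsto (fun δ => a δ ^ p) (𝓝[>] 0) (𝓝 0) := by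
    have := (Real.continuousAt_rpow_const 0 p (Or.inr hp0.le)).tendsto.comp h2
    rwa [Real.zero_rpow hp0.ne'] at this
  have h4 := (h1.const_mul (1 / 2)).add (h3.const_mul (cConst p * k))
  rw [mul_zero, mul_zero, add_zero] at h4
  refine h4.congr fun δ => ?_
  rw [errorBound, Real.sqrt_eq_rpow]
  ring

variable {𝕜 H : Type*} [RCLike 𝕜] [NormedAddCommGroup H] [InnerProductSpace 𝕜 H]

/-! ### The regularizing operator as a bounded Tikhonov solution operator -/

section Tikhonov

/-- `B f` is the minimiser `u ∈ D(A)` of `‖A u - f‖² + a ‖u‖²`, in variational form. -/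
def IsTikhonov (A : H →ₗ.[𝕜] H) (a : ℝ) (B : H →L[𝕜] H) : Prop :=
  ∀ f : H, ∃ hu : B f ∈ A.domain, ∀ z : A.domain,
    inner 𝕜 (A ⟨B f, hu⟩) (A z) + (a : 𝕜) * inner 𝕜 (B f) (z : H) = inner 𝕜 f (A z)

variable {A : H →ₗ.[𝕜] H} {a : ℝ} {B : H →L[𝕜] H}

theorem inner_self_add_eq_zero {g u : H} (ha : 0 < a)
    (h : inner 𝕜 g g + (a : 𝕜) * inner 𝕜 u u = 0) : g = 0 ∧ u = 0 := by
  have h1 : ((‖g‖ ^ 2 + a * ‖u‖ ^ 2 : ℝ) : 𝕜) = 0 := by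
    rw [← h, inner_self_eq_norm_sq_to_K, inner_self_eq_norm_sq_to_K]
    push_cast
    rfl
  have h2 : ‖g‖ ^ 2 + a * ‖u‖ ^ 2 = 0 := by exact_mod_cast h1
  have h3 : 0 ≤ a * ‖u‖ ^ 2 := by positivity
  have h4 : ‖g‖ ^ 2 = 0 := by nlinarith [sq_nonneg ‖g‖]
  have h5 : a * ‖u‖ ^ 2 = 0 := by linarith
  exact ⟨by simpa using h4, by simpa [ha.ne'] using h5⟩

/-- Testing with `z = u = B f` gives `a‖u‖² ≤ ‖f‖‖A u‖ - ‖A u‖²`, and the right side is at most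
`‖f‖²/4`. -/
theorem IsTikhonov.norm_le (hB : IsTikhonov A a B) (ha : 0 < a) (f : H) :
    ‖B f‖ ≤ ‖f‖ / (2 * √a) := by
  obtain ⟨hu, h⟩ := hB f
  have h1 := congrArg RCLike.re (h ⟨B f, hu⟩)
  rw [map_add, RCLike.re_ofReal_mul, inner_self_eq_norm_sq, inner_self_eq_norm_sq] at h1
  have h2 : RCLike.re (inner 𝕜 f (A ⟨B f, hu⟩)) ≤ ‖f‖ * ‖A ⟨B f, hu⟩‖ := re_inner_le_norm _ _
  have hs : 0 < √a := Real.sqrt_pos.2 ha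
  rw [le_div_iff₀ (by positivity)]
  refine abs_le_of_sq_le_sq' ?_ (norm_nonneg f) |>.2
  have h3 : (‖B f‖ * (2 * √a)) ^ 2 = 4 * (a * ‖B f‖ ^ 2) := by
    rw [mul_pow, mul_pow, Real.sq_sqrt ha.le]; ring
  rw [h3]
  nlinarith [sq_nonneg (‖f‖ - 2 * ‖A ⟨B f, hu⟩‖)]

theorem isClosed_toPMap_top (B : H →L[𝕜] H) : ((B : H →ₗ[𝕜] H).toPMap ⊤).IsClosed := by
  have h : (((B : H →ₗ[𝕜] H).toPMap ⊤).graph : Set (H × H)) = {x | x.2 = B x.1} := by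
    ext ⟨x, y⟩
    simp [LinearPMap.mem_graph_iff, eq_comm]
  rw [LinearPMap.IsClosed, h]
  exact isClosed_eq continuous_snd (B.continuous.comp continuous_fst)

variable [CompleteSpace H]

/-- Project `(0, f)` orthogonally, in the Hilbert sum `H ⊕ H`, onto the closed subspace of pairs
`(√a u, A u)`. Orthogonality of the residual to that subspace is the variational identity. -/
theorem exists_isTikhonov (hclosed : A.IsClosed) (ha : 0 < a) :
    ∃ B : H →L[𝕜] H, IsTikhonov A a B := by
  have hs : 0 < √a := Real.sqrt_pos.2 ha
  have hc : ((√a : ℝ) : 𝕜) ≠ 0 := by exact_mod_cast hs.ne'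
  set c : 𝕜 := ((√a : ℝ) : 𝕜) with hcdef
  -- `L` undoes the scaling by `√a`, so the subspace is a continuous preimage of the graph and
  -- inherits its closedness.
  let L : WithLp 2 (H × H) →L[𝕜] H × H :=
    (c⁻¹ • WithLp.fstL 2 𝕜 H H).prod (WithLp.sndL 2 𝕜 H H)
  let S : Submodule 𝕜 (WithLp 2 (H × H)) := A.graph.comap (L : WithLp 2 (H × H) →ₗ[𝕜] H × H)
  have hS : IsClosed (S : Set (WithLp 2 (H × H))) := by
    have h1 : IsClosed (A.graph : Set (H × H)) := hclosed
    exact h1.preimage L.continuous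
  have : CompleteSpace S := hS.completeSpace_coe
  let J : H →L[𝕜] WithLp 2 (H × H) :=
    ((WithLp.prodContinuousLinearEquiv 2 𝕜 H H).symm : H × H →L[𝕜] WithLp 2 (H × H)) ∘L
      ContinuousLinearMap.inr 𝕜 H H
  refine ⟨c⁻¹ • (WithLp.fstL 2 𝕜 H H ∘L S.starProjection ∘L J), fun f => ?_⟩
  set q : WithLp 2 (H × H) := S.starProjection (J f) with hq
  have hqS : q ∈ S := S.starProjection_apply_mem _
  have hBf : (c⁻¹ • (WithLp.fstL 2 𝕜 H H ∘L S.starProjection ∘L J)) f = c⁻¹ • q.fst := rfl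
  have hgr : (c⁻¹ • q.fst, q.snd) ∈ A.graph := hqS
  obtain ⟨y, hy1, hy2⟩ := (LinearPMap.mem_graph_iff _).1 hgr
  simp only at hy1 hy2
  have hdom : c⁻¹ • q.fst ∈ A.domain := hy1 ▸ y.2
  have hval : A ⟨c⁻¹ • q.fst, hdom⟩ = q.snd := by
    rw [← hy2]; congr 1; exact Subtype.ext hy1.symm
  rw [hBf]
  refine ⟨hdom, fun z => ?_⟩
  rw [hval]
  have hzS : (WithLp.toLp 2 (c • (z : H), A z) : WithLp 2 (H × H)) ∈ S := by
    change (c⁻¹ • c • (z : H), A z) ∈ A.graph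
    rw [inv_smul_smul₀ hc]
    exact A.mem_graph z
  have h0 := S.starProjection_inner_eq_zero (J f) _ hzS
  rw [← hq, inner_sub_left, WithLp.prod_inner_apply, WithLp.prod_inner_apply] at h0
  have e1 : (WithLp.ofLp (J f)).fst = 0 := rfl
  have e2 : (WithLp.ofLp (J f)).snd = f := rfl
  rw [e1, e2] at h0
  simp only [inner_zero_left, inner_smul_right, mul_zero, zero_add] at h0
  have hcc : c * c = (a : 𝕜) := by
    rw [hcdef, ← RCLike.ofReal_mul, Real.mul_self_sqrt ha.le]
  have hconj : (starRingEnd 𝕜) c⁻¹ = c⁻¹ := by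
    rw [hcdef, ← RCLike.ofReal_inv, RCLike.conj_ofReal]
  rw [inner_smul_left, hconj, ← hcc]
  have h6 : c * c * (c⁻¹ * inner 𝕜 q.fst (z : H)) = c * inner 𝕜 q.fst (z : H) := by
    field_simp
  rw [h6]
  have h7 := sub_eq_zero.1 h0
  rw [h7, add_comm]
  rfl

theorem mem_adjoint_graph_iff (hdense : Dense (A.domain : Set H)) {g h : H} :
    (∃ hg : g ∈ A.adjoint.domain, A.adjoint ⟨g, hg⟩ = h) ↔
      ∀ z : A.domain, inner 𝕜 h (z : H) = inner 𝕜 g (A z) := by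
  constructor
  · rintro ⟨hg, rfl⟩ z
    exact A.adjoint_isFormalAdjoint hdense ⟨g, hg⟩ z
  · intro H1
    have hg := A.mem_adjoint_domain_of_exists g ⟨h, H1⟩
    exact ⟨hg, A.adjoint_apply_eq hdense ⟨g, hg⟩ H1⟩

theorem IsTikhonov.adjoint_residual (hB : IsTikhonov A a B) (hdense : Dense (A.domain : Set H))
    (f : H) (hu : B f ∈ A.domain) :
    ∃ hg : f - A ⟨B f, hu⟩ ∈ A.adjoint.domain,
      A.adjoint ⟨f - A ⟨B f, hu⟩, hg⟩ = (a : 𝕜) • B f := by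
  rw [mem_adjoint_graph_iff hdense]
  intro z
  obtain ⟨_, h⟩ := hB f
  rw [inner_sub_left, ← h z, inner_smul_left, RCLike.conj_ofReal]
  ring

/-- Let `h ⊥ D(A*)` and take `a = 1`, `u = B h`, `g = h - A u`. Then `A* g = u`, so `0 = (g, h) =
‖g‖² + (g, A u) = ‖g‖² + ‖u‖²`, which forces `u = 0` and `h = g = 0`. -/
theorem dense_adjoint_domain (hclosed : A.IsClosed) (hdense : Dense (A.domain : Set H)) :
    Dense (A.adjoint.domain : Set H) := by
  obtain ⟨B, hB⟩ := exists_isTikhonov hclosed one_pos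
  rw [Submodule.dense_iff_topologicalClosure_eq_top,
    Submodule.topologicalClosure_eq_top_iff, Submodule.eq_bot_iff]
  intro h hh
  obtain ⟨hu, -⟩ := hB h
  obtain ⟨hg, hgv⟩ := hB.adjoint_residual hdense h hu
  have h1 := (mem_adjoint_graph_iff hdense).1 ⟨hg, hgv⟩ ⟨B h, hu⟩
  have h2 : inner 𝕜 (h - A ⟨B h, hu⟩) h = 0 := (Submodule.mem_orthogonal _ _).1 hh _ hg
  have h3 : inner 𝕜 (h - A ⟨B h, hu⟩) (h - A ⟨B h, hu⟩) +
      ((1 : ℝ) : 𝕜) * inner 𝕜 (B h) (B h) = 0 := by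
    rw [inner_sub_right, h2, ← h1, inner_smul_left, RCLike.conj_ofReal]
    ring
  obtain ⟨h4, h5⟩ := inner_self_add_eq_zero one_pos h3
  have h6 : A ⟨B h, hu⟩ = 0 := by
    have : (⟨B h, hu⟩ : A.domain) = 0 := Subtype.ext h5
    rw [this, LinearPMap.map_zero]
  rwa [h6, sub_zero] at h4

theorem inner_opT (hdense : Dense (A.domain : Set H)) (x : (opT A).domain)
    (hx : (x : H) ∈ A.domain) (z : A.domain) :
    inner 𝕜 (opT A x) (z : H) = inner 𝕜 (A ⟨x, hx⟩) (A z) := by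
  obtain ⟨x, hxT⟩ := x
  obtain ⟨hx', hA⟩ := mem_opMul_domain.1 hxT
  change inner 𝕜 (A.adjoint ⟨A ⟨x, hx'⟩, hA⟩) (z : H) = _
  exact A.adjoint_isFormalAdjoint hdense ⟨_, hA⟩ z

theorem opT_nonneg (hdense : Dense (A.domain : Set H)) (x : (opT A).domain) :
    0 ≤ RCLike.re (inner 𝕜 (opT A x) (x : H)) := by
  obtain ⟨hx, -⟩ := mem_opMul_domain.1 x.2
  rw [inner_opT hdense x hx ⟨x, hx⟩, inner_self_eq_norm_sq]
  positivity

theorem ker_opTa (hdense : Dense (A.domain : Set H)) (ha : 0 < a) :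
    LinearMap.ker (opTa A a).toFun = ⊥ := by
  rw [LinearMap.ker_eq_bot']
  intro x hx
  change (a : 𝕜) • (x : H) + opT A x = 0 at hx
  obtain ⟨hxA, -⟩ := mem_opMul_domain.1 x.2
  have h1 : inner 𝕜 ((a : 𝕜) • (x : H) + opT A x) (x : H) = 0 := by rw [hx, inner_zero_left]
  rw [inner_add_left, inner_smul_left, RCLike.conj_ofReal, add_comm,
    inner_opT hdense x hxA ⟨x, hxA⟩] at h1
  exact Subtype.ext (inner_self_add_eq_zero ha h1).2

theorem mem_opT_graph (hdense : Dense (A.domain : Set H)) {x h : H} (hx : x ∈ A.domain)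
    (H1 : ∀ z : A.domain, inner 𝕜 h (z : H) = inner 𝕜 (A ⟨x, hx⟩) (A z)) :
    ∃ hxT : x ∈ (opT A).domain, opT A ⟨x, hxT⟩ = h := by
  obtain ⟨hg, hgv⟩ := (mem_adjoint_graph_iff hdense).2 H1
  exact ⟨mem_opMul_domain.2 ⟨hx, hg⟩, hgv⟩

/-- When `A* f` exists, the variational identity reads `(A u, A z) = (A* f - a u, z)`; hence `u ∈
D(T)` and `T_a u = A* f`. -/
theorem IsTikhonov.mem_graph_of_mem_adjoint (hB : IsTikhonov A a B)
    (hdense : Dense (A.domain : Set H)) (ha : 0 < a) {f : H} (hf : f ∈ A.adjoint.domain) :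
    (f, B f) ∈ (preRegOp A a).graph := by
  obtain ⟨hu, h⟩ := hB f
  obtain ⟨huT, hT⟩ : ∃ hxT : B f ∈ (opT A).domain,
      opT A ⟨B f, hxT⟩ = A.adjoint ⟨f, hf⟩ - (a : 𝕜) • B f := by
    refine mem_opT_graph hdense hu fun z => ?_
    rw [inner_sub_left, inner_smul_left, RCLike.conj_ofReal,
      A.adjoint_isFormalAdjoint hdense ⟨f, hf⟩ z, ← h z]
    ring
  have h1 : opTa A a ⟨B f, huT⟩ = A.adjoint ⟨f, hf⟩ := by
    change (a : 𝕜) • B f + opT A ⟨B f, huT⟩ = _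
    rw [hT]; abel
  have hmem := LinearPMap.mem_inverse_graph (ker_opTa hdense ha) ⟨B f, huT⟩
  rw [h1] at hmem
  have hd := LinearPMap.mem_domain_of_mem_graph hmem
  refine (LinearPMap.mem_graph_iff _).2 ⟨⟨f, mem_opMul_domain.2 ⟨hf, hd⟩⟩, rfl, ?_⟩
  exact LinearPMap.inverse_apply_eq (ker_opTa hdense ha) (y := ⟨_, hd⟩) (x := ⟨B f, huT⟩) h1

theorem IsTikhonov.preRegOp_le (hB : IsTikhonov A a B)
    (hdense : Dense (A.domain : Set H)) (ha : 0 < a) :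
    preRegOp A a ≤ (B : H →ₗ[𝕜] H).toPMap ⊤ := by
  refine LinearPMap.le_of_le_graph ?_
  rintro ⟨f, u⟩ hfu
  have hf : f ∈ (preRegOp A a).domain := LinearPMap.mem_domain_of_mem_graph hfu
  obtain ⟨hf', -⟩ := mem_opMul_domain.1 hf
  have := LinearPMap.mem_graph_snd_inj _ hfu (hB.mem_graph_of_mem_adjoint hdense ha hf') rfl
  subst this
  exact (LinearPMap.mem_graph_iff _).2 ⟨⟨f, trivial⟩, rfl, rfl⟩

theorem IsTikhonov.isClosable_preRegOp (hB : IsTikhonov A a B)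
    (hdense : Dense (A.domain : Set H)) (ha : 0 < a) : (preRegOp A a).IsClosable :=
  (isClosed_toPMap_top B).isClosable.leIsClosable (hB.preRegOp_le hdense ha)

theorem IsTikhonov.mem_graph_regOp (hB : IsTikhonov A a B) (hclosed : A.IsClosed)
    (hdense : Dense (A.domain : Set H)) (ha : 0 < a) (f : H) :
    (f, B f) ∈ (regOp A a).graph := by
  rw [regOp, ← (hB.isClosable_preRegOp hdense ha).graph_closure_eq_closure_graph]
  have hf : f ∈ closure (A.adjoint.domain : Set H) := dense_adjoint_domain hclosed hdense f
  exact map_mem_closure (f := fun x => (x, B x)) (by fun_prop) hf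
    fun x hx => hB.mem_graph_of_mem_adjoint hdense ha hx

theorem IsTikhonov.regOp_eq (hB : IsTikhonov A a B) (hclosed : A.IsClosed)
    (hdense : Dense (A.domain : Set H)) (ha : 0 < a) (f : H) (hf : f ∈ (regOp A a).domain) :
    regOp A a ⟨f, hf⟩ = B f :=
  LinearPMap.mem_graph_snd_inj _ ((regOp A a).mem_graph ⟨f, hf⟩)
    (hB.mem_graph_regOp hclosed hdense ha f) rfl

/-- The bias equals `a (T + a)⁻¹ v`. Only `v ∈ D(A)` is needed, since the difference lies in `D(T)`
even when `v` does not. -/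
theorem IsTikhonov.opT_sub (hB : IsTikhonov A a B) (hdense : Dense (A.domain : Set H))
    {v : H} (hv : v ∈ A.domain) :
    ∃ hw : v - B (A ⟨v, hv⟩) ∈ (opT A).domain,
      opT A ⟨v - B (A ⟨v, hv⟩), hw⟩ + (a : 𝕜) • (v - B (A ⟨v, hv⟩)) = (a : 𝕜) • v := by
  obtain ⟨hu, h⟩ := hB (A ⟨v, hv⟩)
  obtain ⟨hw, e⟩ := mem_opT_graph hdense (x := v - B (A ⟨v, hv⟩))
    (h := (a : 𝕜) • B (A ⟨v, hv⟩)) (A.domain.sub_mem hv hu) fun z => by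
      have e1 : (⟨v - B (A ⟨v, hv⟩), A.domain.sub_mem hv hu⟩ : A.domain) =
        ⟨v, hv⟩ - ⟨B (A ⟨v, hv⟩), hu⟩ := rfl
      rw [e1, LinearPMap.map_sub, inner_sub_left, ← h z, inner_smul_left, RCLike.conj_ofReal]
      ring
  refine ⟨hw, ?_⟩
  rw [e, smul_sub]
  abel

end Tikhonov

variable [CompleteSpace H]

/-! ### Spectral estimates -/

namespace ResolutionOfIdentity

variable (E : ResolutionOfIdentity 𝕜 H)

/-- The distribution function `s ↦ (E_s y, y)` as a Stieltjes function. -/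
def stieltjes (y : H) : StieltjesFunction ℝ where
  toFun := E.distrib y
  mono' := E.distrib_mono y
  right_continuous' := E.distrib_right_continuous y

theorem measure_eq_stieltjes (y : H) : E.measure y = (E.stieltjes y).measure := rfl

theorem tendsto_distrib_atBot (y : H) : Tendsto (E.stieltjes y) atBot (𝓝 0) := by
  have h := ((E.tendsto_atBot y).norm).pow 2
  rw [norm_zero, zero_pow two_ne_zero] at h
  exact h.congr fun s => (E.distrib_eq_norm_sq y s).symm

theorem tendsto_distrib_atTop (y : H) : Tendsto (E.stieltjes y) atTop (𝓝 (‖y‖ ^ 2)) :=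
  (((E.tendsto_atTop y).norm).pow 2).congr fun s => (E.distrib_eq_norm_sq y s).symm

theorem measure_univ (y : H) : E.measure y univ = ENNReal.ofReal (‖y‖ ^ 2) := by
  rw [measure_eq_stieltjes, StieltjesFunction.measure_univ _ (E.tendsto_distrib_atBot y)
    (E.tendsto_distrib_atTop y), sub_zero]

instance isFiniteMeasure_measure (y : H) : IsFiniteMeasure (E.measure y) :=
  ⟨by rw [E.measure_univ]; exact ENNReal.ofReal_lt_top⟩

theorem real_measure_univ (y : H) : (E.measure y).real univ = ‖y‖ ^ 2 := by
  rw [Measure.real, E.measure_univ, ENNReal.toReal_ofReal (by positivity)]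

theorem inner_proj (s : ℝ) (x y : H) : inner 𝕜 (E.proj s x) y = inner 𝕜 x (E.proj s y) := by
  have h1 : ContinuousLinearMap.adjoint (E.proj s) = E.proj s :=
    (E.isStarProjection s).isSelfAdjoint
  rw [← ContinuousLinearMap.adjoint_inner_left, h1]

theorem proj_proj_of_le {s t : ℝ} (h : s ≤ t) (x : H) :
    E.proj s (E.proj t x) = E.proj s x :=
  congrArg (fun B : H →L[𝕜] H => B x) (E.mul_of_le s t h)

theorem proj_proj_of_ge {s t : ℝ} (h : s ≤ t) (x : H) :
    E.proj t (E.proj s x) = E.proj s x := by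
  refine ext_inner_right 𝕜 fun y => ?_
  rw [inner_proj, inner_proj, E.proj_proj_of_le h, inner_proj]

theorem proj_comm (s t : ℝ) (x : H) : E.proj s (E.proj t x) = E.proj t (E.proj s x) := by
  rcases le_total s t with h | h
  · rw [E.proj_proj_of_le h, E.proj_proj_of_ge h]
  · rw [E.proj_proj_of_ge h, E.proj_proj_of_le h]

/-- The spectral projection `E_t - E_s` of the interval `(s, t]`. -/
def projIoc (s t : ℝ) : H →L[𝕜] H := E.proj t - E.proj s

theorem projIoc_apply (s t : ℝ) (x : H) : E.projIoc s t x = E.proj t x - E.proj s x := rfl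

theorem inner_projIoc (s t : ℝ) (x y : H) :
    inner 𝕜 (E.projIoc s t x) y = inner 𝕜 x (E.projIoc s t y) := by
  rw [projIoc_apply, projIoc_apply, inner_sub_left, inner_sub_right, inner_proj, inner_proj]

variable {s t : ℝ}

theorem projIoc_projIoc (h : s ≤ t) (x : H) :
    E.projIoc s t (E.projIoc s t x) = E.projIoc s t x := by
  simp only [projIoc_apply, map_sub, E.proj_proj_of_le h, E.proj_proj_of_ge h,
    E.proj_proj_of_le le_rfl, sub_self, sub_zero]

theorem norm_projIoc_sq (h : s ≤ t) (x : H) :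
    ‖E.projIoc s t x‖ ^ 2 = RCLike.re (inner 𝕜 x (E.projIoc s t x)) := by
  rw [← inner_self_eq_norm_sq (𝕜 := 𝕜), inner_projIoc, E.projIoc_projIoc h]

theorem norm_sq_eq_projIoc (h : s ≤ t) (x : H) :
    ‖x‖ ^ 2 = ‖E.projIoc s t x‖ ^ 2 + ‖x - E.projIoc s t x‖ ^ 2 := by
  rw [norm_sub_sq (𝕜 := 𝕜), ← E.norm_projIoc_sq h]
  ring

theorem measure_Ioc (h : s ≤ t) (x : H) :
    E.measure x (Ioc s t) = ENNReal.ofReal (‖E.projIoc s t x‖ ^ 2) := by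
  rw [measure_eq_stieltjes, StieltjesFunction.measure_Ioc]
  congr 1
  change E.distrib x t - E.distrib x s = _
  rw [E.norm_projIoc_sq h, projIoc_apply, inner_sub_right, map_sub, distrib, distrib,
    inner_proj, inner_proj]

/-- Each `E_r` commutes with `E_t - E_s`, so Pythagoras applied to `E_r x` splits the distribution
function. -/
theorem measure_eq_add (h : s ≤ t) (x : H) :
    E.measure x = E.measure (E.projIoc s t x) + E.measure (x - E.projIoc s t x) := by
  simp only [measure_eq_stieltjes]
  rw [← StieltjesFunction.measure_add]
  congr 1
  ext r
  change E.distrib x r = E.distrib (E.projIoc s t x) r + E.distrib (x - E.projIoc s t x) r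
  have hc : E.proj r (E.projIoc s t x) = E.projIoc s t (E.proj r x) := by
    rw [projIoc_apply, projIoc_apply, map_sub, E.proj_comm r t, E.proj_comm r s]
  rw [E.distrib_eq_norm_sq, E.distrib_eq_norm_sq, E.distrib_eq_norm_sq, map_sub, hc]
  exact E.norm_sq_eq_projIoc h _

theorem ae_mem_Ioc (h : s ≤ t) (x : H) :
    ∀ᵐ r ∂(E.measure (E.projIoc s t x)), r ∈ Ioc s t := by
  rw [ae_iff]
  change E.measure (E.projIoc s t x) (Ioc s t)ᶜ = 0
  rw [measure_compl measurableSet_Ioc (measure_ne_top _ _), E.measure_univ, E.measure_Ioc h,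
    E.projIoc_projIoc h, tsub_self]

/-! ### The quadratic form of `T` on spectral subspaces -/

namespace IsResolutionOf

variable {E} {T : H →ₗ.[𝕜] H} (hE : E.IsResolutionOf T)
include hE

theorem integrable_id (x : T.domain) : Integrable (fun r : ℝ => r) (E.measure (x : H)) := by
  have h1 := (hE.mem_domain_iff x).1 x.2
  have h2 : Integrable (fun r : ℝ => r ^ 2) (E.measure (x : H)) := by
    refine ⟨by fun_prop, ?_⟩
    rw [hasFiniteIntegral_iff_ofReal (ae_of_all _ fun r => sq_nonneg r)]
    exact h1
  refine (h2.add (integrable_const (1 : ℝ))).mono' (by fun_prop) (ae_of_all _ fun r => ?_)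
  rw [Real.norm_eq_abs, Pi.add_apply]
  nlinarith [sq_nonneg (|r| - 1), sq_abs r]

theorem projIoc_mem (h : s ≤ t) (x : H) : E.projIoc s t x ∈ T.domain := by
  rw [hE.mem_domain_iff]
  have h1 : ∀ᵐ r ∂(E.measure (E.projIoc s t x)),
      ENNReal.ofReal (r ^ 2) ≤ ENNReal.ofReal (s ^ 2 + t ^ 2) := by
    filter_upwards [E.ae_mem_Ioc h x] with r hr
    refine ENNReal.ofReal_le_ofReal ?_
    rcases le_total 0 r with h0 | h0 <;> nlinarith [hr.1, hr.2, sq_nonneg s, sq_nonneg t]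
  refine (lintegral_mono_ae h1).trans_lt ?_
  rw [lintegral_const]
  exact ENNReal.mul_lt_top ENNReal.ofReal_lt_top (measure_lt_top _ _)

theorem re_inner_eq (x : T.domain) :
    RCLike.re (inner 𝕜 (T x) (x : H)) = ∫ r, r ∂(E.measure (x : H)) := by
  rw [hE.inner_eq, RCLike.ofReal_re]

/-- The components of `x` in the range of a spectral projection and in its complement are
orthogonal with respect to the quadratic form of `T`. -/
theorem re_inner_projIoc_sub (h : s ≤ t) (x : T.domain)
    (hP : E.projIoc s t x ∈ T.domain) :
    RCLike.re (inner 𝕜 (T x) (E.projIoc s t (x : H))) =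
      RCLike.re (inner 𝕜 (T ⟨E.projIoc s t x, hP⟩) (E.projIoc s t (x : H))) := by
  set u : T.domain := ⟨E.projIoc s t x, hP⟩ with hu
  set v : T.domain := x - u with hv
  have hx : x = u + v := by rw [hv]; abel
  have huc : (u : H) = E.projIoc s t x := rfl
  -- Additivity of the spectral measure gives `(T x, x) = (T u, u) + (T v, v)`, so the real parts of
  -- the two cross terms sum to zero. Symmetry makes them equal, hence each vanishes.
  have h1 := hE.re_inner_eq x
  rw [E.measure_eq_add h, ← huc, ← (show (v : H) = x - u from rfl), integral_add_measure (hE.integrable_id u) (hE.integrable_id v),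
    ← hE.re_inner_eq u, ← hE.re_inner_eq v] at h1
  have hxc : (x : H) = u + v := congrArg Subtype.val hx
  have h3 : T x = T u + T v := by conv_lhs => rw [hx, LinearPMap.map_add]
  rw [h3, hxc, inner_add_left, inner_add_right, inner_add_right, map_add, map_add, map_add] at h1
  have h4 : RCLike.re (inner 𝕜 (T u) (v : H)) = RCLike.re (inner 𝕜 (T v) (u : H)) := by
    rw [hE.symmetric u v, ← inner_conj_symm, RCLike.conj_re]
  rw [← huc, h3, inner_add_left, map_add]
  linarith

theorem mul_norm_projIoc_sq_le (h : s ≤ t) (x : T.domain)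
    (hP : E.projIoc s t x ∈ T.domain) :
    s * ‖E.projIoc s t (x : H)‖ ^ 2 ≤
      RCLike.re (inner 𝕜 (T ⟨E.projIoc s t x, hP⟩) (E.projIoc s t (x : H))) := by
  have h1 := hE.re_inner_eq ⟨_, hP⟩
  rw [h1]
  have h2 := integral_mono_ae (integrable_const s) (hE.integrable_id ⟨_, hP⟩)
    ((E.ae_mem_Ioc h x).mono fun r hr => hr.1.le)
  rwa [integral_const, E.real_measure_univ, smul_eq_mul, mul_comm] at h2

theorem le_mul_norm_projIoc_sq (h : s ≤ t) (x : T.domain)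
    (hP : E.projIoc s t x ∈ T.domain) :
    RCLike.re (inner 𝕜 (T ⟨E.projIoc s t x, hP⟩) (E.projIoc s t (x : H))) ≤
      t * ‖E.projIoc s t (x : H)‖ ^ 2 := by
  have h1 := hE.re_inner_eq ⟨_, hP⟩
  rw [h1]
  have h2 := integral_mono_ae (hE.integrable_id ⟨_, hP⟩) (integrable_const t)
    ((E.ae_mem_Ioc h x).mono fun r hr => hr.2)
  rwa [integral_const, E.real_measure_univ, smul_eq_mul, mul_comm] at h2

/-- A spectral form of `w = a (T + a)⁻¹ y`. -/
theorem add_mul_norm_projIoc_le {a : ℝ} (ha : 0 < a) (h : s ≤ t) {y : H} (w : T.domain)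
    (hw : T w + (a : 𝕜) • (w : H) = (a : 𝕜) • y) :
    (s + a) * ‖E.projIoc s t (w : H)‖ ≤ a * ‖E.projIoc s t y‖ := by
  have hP := hE.projIoc_mem h (w : H)
  set u := E.projIoc s t (w : H) with hu
  -- The equation for `w` is tested against `u`; on the spectral interval the form of `T` is at
  -- least `s‖u‖²`.
  have h1 : (s + a) * ‖u‖ ^ 2 ≤ RCLike.re (inner 𝕜 (T w + (a : 𝕜) • (w : H)) u) := by
    rw [inner_add_left, map_add, hE.re_inner_projIoc_sub h w hP, inner_smul_left,
      RCLike.conj_ofReal, RCLike.re_ofReal_mul, ← E.norm_projIoc_sq h, add_mul]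
    gcongr
    exact hE.mul_norm_projIoc_sq_le h w hP
  have h2 : inner 𝕜 y u = inner 𝕜 (E.projIoc s t y) u := by
    rw [inner_projIoc, hu, E.projIoc_projIoc h]
  rw [hw, inner_smul_left, RCLike.conj_ofReal, RCLike.re_ofReal_mul, h2] at h1
  have h3 : (s + a) * ‖u‖ ^ 2 ≤ a * (‖E.projIoc s t y‖ * ‖u‖) :=
    h1.trans (mul_le_mul_of_nonneg_left (re_inner_le_norm _ _) ha.le)
  rcases (norm_nonneg u).eq_or_lt with h0 | h0
  · rw [← h0, mul_zero]; positivity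
  · refine le_of_mul_le_mul_right ?_ h0
    linarith

/-- On the range of `E_t - E_s` with `t < 0` the form is at most `t‖·‖²`, so nonnegativity kills the
projection; countably many such intervals cover the negative axis. -/
theorem measure_Iio_zero (hT : ∀ x : T.domain, 0 ≤ RCLike.re (inner 𝕜 (T x) (x : H)))
    (y : H) : E.measure y (Iio 0) = 0 := by
  have key : ∀ s t : ℝ, s ≤ t → t < 0 → E.projIoc s t y = 0 := by
    intro s t hst ht
    have hP := hE.projIoc_mem hst y
    have h1 := hE.le_mul_norm_projIoc_sq hst ⟨_, hP⟩ (hE.projIoc_mem hst _)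
    have h2 := hT ⟨_, hE.projIoc_mem hst (E.projIoc s t y)⟩
    have h3 : ‖E.projIoc s t y‖ ^ 2 = 0 := by
      have h4 := h2.trans h1
      rw [E.projIoc_projIoc hst] at h4
      nlinarith [sq_nonneg ‖E.projIoc s t y‖]
    simpa using h3
  have hsub : Iio (0 : ℝ) ⊆ ⋃ n : ℕ, Ioc (-((n : ℝ) + 1)) (-(1 / ((n : ℝ) + 1))) := by
    intro r hr
    obtain ⟨n, hn⟩ := exists_nat_gt (max (-r) (1 / (-r)))
    have hr' : 0 < -r := by simpa using hr
    have h1 : -r < n := lt_of_le_of_lt (le_max_left _ _) hn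
    have h2 : 1 / (-r) < n := lt_of_le_of_lt (le_max_right _ _) hn
    refine mem_iUnion.2 ⟨n, by linarith, ?_⟩
    rw [div_lt_iff₀ hr'] at h2
    have h3 : 1 / ((n : ℝ) + 1) ≤ -r := by
      rw [div_le_iff₀ (by positivity)]
      nlinarith
    linarith
  refine measure_mono_null hsub (measure_iUnion_null fun n => ?_)
  have hn : (0 : ℝ) < (n : ℝ) + 1 := by positivity
  have hle : -((n : ℝ) + 1) ≤ -(1 / ((n : ℝ) + 1)) := by
    rw [neg_le_neg_iff, div_le_iff₀ hn]
    nlinarith [(n.cast_nonneg : (0 : ℝ) ≤ n)]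
  rw [E.measure_Ioc hle, key _ _ hle (by simpa using hn)]
  simp

end IsResolutionOf

end ResolutionOfIdentity

/-! ### Decay of the bias on the source set -/

namespace ResolutionOfIdentity

variable {E : ResolutionOfIdentity 𝕜 H} {T : H →ₗ.[𝕜] H} {a p : ℝ} {y : H}

theorem measure_singleton_zero_of_lintegral_ne_top (hp0 : 0 < p)
    (hy : ∫⁻ s in Ici (0 : ℝ), ENNReal.ofReal s ^ (-2 * p) ∂(E.measure y) ≠ ∞) :
    E.measure y {0} = 0 := by
  by_contra hne
  refine hy (top_le_iff.1 ?_)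
  calc ∞ = ∫⁻ s in {(0 : ℝ)}, ENNReal.ofReal s ^ (-2 * p) ∂(E.measure y) := by
        rw [lintegral_singleton, ENNReal.ofReal_zero, ENNReal.zero_rpow_of_neg (by linarith),
          ENNReal.top_mul hne]
    _ ≤ _ := lintegral_mono_set (by simp)

namespace IsResolutionOf

variable (hE : E.IsResolutionOf T)
  (hT : ∀ x : T.domain, 0 ≤ RCLike.re (inner 𝕜 (T x) (x : H)))
include hE hT

theorem measure_Iic_zero (ha : 0 < a) (hy : E.measure y {0} = 0) (w : T.domain)
    (hw : T w + (a : 𝕜) • (w : H) = (a : 𝕜) • y) : E.measure (w : H) (Iic 0) = 0 := by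
  have hle : -(a / 2) ≤ 0 := by linarith
  -- The interval `(-a/2, 0]` catches a possible atom at `0` while keeping the factor `s + a = a/2`
  -- positive.
  have h1 := hE.add_mul_norm_projIoc_le ha hle w hw
  have h2 : E.measure y (Ioc (-(a / 2)) 0) = 0 := by
    refine measure_mono_null (t := Iio 0 ∪ {0}) ?_
      (measure_union_null (hE.measure_Iio_zero hT y) hy)
    intro r hr
    exact hr.2.lt_or_eq
  rw [E.measure_Ioc hle, ENNReal.ofReal_eq_zero] at h2
  have h3 : ‖E.projIoc (-(a / 2)) 0 y‖ = 0 := by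
    nlinarith [norm_nonneg (E.projIoc (-(a / 2)) 0 y)]
  have h4 : ‖E.projIoc (-(a / 2)) 0 (w : H)‖ = 0 := by
    rw [h3] at h1
    nlinarith [norm_nonneg (E.projIoc (-(a / 2)) 0 (w : H))]
  refine measure_mono_null (t := Iio 0 ∪ Ioc (-(a / 2)) 0) ?_
    (measure_union_null (hE.measure_Iio_zero hT _) ?_)
  · intro r hr
    rcases (show r ≤ 0 from hr).lt_or_eq with h | h
    · exact Or.inl h
    · exact Or.inr ⟨by linarith, hr⟩
  · rw [E.measure_Ioc hle, h4]
    simp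

omit hT in
-- The resolvent estimate uses the left endpoint `s`, while the weight `x^(-2p)` is bounded below by
-- its value at the right endpoint `s r`. The mismatch costs exactly `r^(2p)`.
theorem measure_Ioc_le (hp0 : 0 < p) (hp1 : p < 1) (ha : 0 < a) (w : T.domain)
    (hw : T w + (a : 𝕜) • (w : H) = (a : 𝕜) • y) {s r : ℝ} (hs : 0 < s) (hr : 1 < r) :
    E.measure (w : H) (Ioc s (s * r)) ≤
      ENNReal.ofReal ((cConst p * a ^ p) ^ 2 * r ^ (2 * p)) *
        ∫⁻ x in Ioc s (s * r), ENNReal.ofReal x ^ (-2 * p) ∂(E.measure y) := by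
  have hr0 : 0 < r := by linarith
  have hle : s ≤ s * r := by nlinarith
  have hc := cConst_pos hp0 hp1
  have h1 : ENNReal.ofReal ((s * r) ^ (-2 * p)) * E.measure y (Ioc s (s * r)) ≤
      ∫⁻ x in Ioc s (s * r), ENNReal.ofReal x ^ (-2 * p) ∂(E.measure y) := by
    rw [← setLIntegral_const]
    refine setLIntegral_mono' measurableSet_Ioc fun x hx => ?_
    have hx0 : 0 < x := hs.trans hx.1
    rw [ENNReal.ofReal_rpow_of_pos hx0]
    exact ENNReal.ofReal_le_ofReal (Real.rpow_le_rpow_of_nonpos hx0 hx.2 (by linarith))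
  refine le_trans ?_ (mul_le_mul_right h1 _)
  rw [E.measure_Ioc hle, E.measure_Ioc hle, ← mul_assoc, ← ENNReal.ofReal_mul (by positivity),
    ← ENNReal.ofReal_mul (by positivity)]
  refine ENNReal.ofReal_le_ofReal ?_
  have h2 := hE.add_mul_norm_projIoc_le ha hle w hw
  have h3 : ‖E.projIoc s (s * r) (w : H)‖ ≤
      cConst p * a ^ p * s ^ (-p) * ‖E.projIoc s (s * r) y‖ := by
    rw [mul_comm, ← le_div_iff₀ (by positivity), mul_div_right_comm] at h2
    exact h2.trans (by gcongr; exact div_add_le_cConst hp0 hp1 hs ha)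
  have h4 : r ^ (2 * p) * (s * r) ^ (-2 * p) = (s ^ (-p)) ^ 2 := by
    rw [Real.mul_rpow hs.le hr0.le, mul_left_comm, ← Real.rpow_add hr0, ← Real.rpow_mul_natCast hs.le]
    rw [show 2 * p + -2 * p = 0 by ring, Real.rpow_zero, mul_one]
    congr 1
    push_cast
    ring
  calc _ ≤ (cConst p * a ^ p * s ^ (-p) * ‖E.projIoc s (s * r) y‖) ^ 2 := by gcongr
    _ = _ := by rw [mul_assoc _ (r ^ (2 * p)), h4]; ring

/-- The qualification estimate `‖a (T + a)⁻¹ y‖ ≤ c_p k a^p` on the source set. -/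
theorem norm_le_of_lintegral_le (hp0 : 0 < p) (hp1 : p < 1) (ha : 0 < a) {k : ℝ} (hk : 0 < k)
    (hy : ∫⁻ s in Ici (0 : ℝ), ENNReal.ofReal s ^ (-2 * p) ∂(E.measure y) ≤
      ENNReal.ofReal (k ^ 2))
    (w : T.domain) (hw : T w + (a : 𝕜) • (w : H) = (a : 𝕜) • y) :
    ‖(w : H)‖ ≤ cConst p * k * a ^ p := by
  have hc := cConst_pos hp0 hp1
  have hy0 : E.measure y {0} = 0 := measure_singleton_zero_of_lintegral_ne_top hp0
    (ne_top_of_le_ne_top ENNReal.ofReal_ne_top hy)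
  -- A geometric partition makes the loss `r^(2p)` the same on every interval, so it factors out of
  -- the sum and disappears as `r → 1`.
  have key : ∀ r : ℝ, 1 < r → ‖(w : H)‖ ^ 2 ≤ (cConst p * a ^ p) ^ 2 * r ^ (2 * p) * k ^ 2 := by
    intro r hr
    have hr0 : 0 < r := by linarith
    have hcov : Ioi (0 : ℝ) ⊆ ⋃ n : ℤ, Ioc (r ^ n) (r ^ n * r) := by
      intro x hx
      obtain ⟨n, hn⟩ := exists_mem_Ioc_zpow hx hr
      rw [zpow_add_one₀ hr0.ne'] at hn
      exact mem_iUnion.2 ⟨n, hn⟩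
    have hdisj : Pairwise (Function.onFun Disjoint fun n : ℤ => Ioc (r ^ n) (r ^ n * r)) := by
      have hm : Monotone fun n : ℤ => r ^ n := (zpow_right_strictMono₀ hr).monotone
      have := hm.pairwise_disjoint_on_Ioc_succ
      simpa only [Order.succ_eq_add_one, zpow_add_one₀ hr0.ne'] using this
    have hsub : (⋃ n : ℤ, Ioc (r ^ n) (r ^ n * r)) ⊆ Ici (0 : ℝ) :=
      iUnion_subset fun n x hx => ((zpow_pos hr0 n).trans hx.1).le
    have h1 : E.measure (w : H) univ ≤
        ENNReal.ofReal ((cConst p * a ^ p) ^ 2 * r ^ (2 * p)) * ENNReal.ofReal (k ^ 2) := by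
      calc E.measure (w : H) univ ≤ E.measure (w : H) (Iic 0) + E.measure (w : H) (Ioi 0) := by
            rw [← Iic_union_Ioi (a := (0 : ℝ))]; exact measure_union_le _ _
        _ = E.measure (w : H) (Ioi 0) := by rw [hE.measure_Iic_zero hT ha hy0 w hw, zero_add]
        _ ≤ ∑' n : ℤ, E.measure (w : H) (Ioc (r ^ n) (r ^ n * r)) :=
            (measure_mono hcov).trans (measure_iUnion_le _)
        _ ≤ ∑' n : ℤ, ENNReal.ofReal ((cConst p * a ^ p) ^ 2 * r ^ (2 * p)) *
              ∫⁻ x in Ioc (r ^ n) (r ^ n * r), ENNReal.ofReal x ^ (-2 * p) ∂(E.measure y) :=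
            ENNReal.tsum_le_tsum fun n => hE.measure_Ioc_le hp0 hp1 ha w hw (zpow_pos hr0 n) hr
        _ = ENNReal.ofReal ((cConst p * a ^ p) ^ 2 * r ^ (2 * p)) *
              ∫⁻ x in ⋃ n : ℤ, Ioc (r ^ n) (r ^ n * r),
                ENNReal.ofReal x ^ (-2 * p) ∂(E.measure y) := by
            rw [ENNReal.tsum_mul_left, lintegral_iUnion (fun _ => measurableSet_Ioc) hdisj]
        _ ≤ _ := mul_le_mul_right ((lintegral_mono_set hsub).trans hy) _
    rw [E.measure_univ, ← ENNReal.ofReal_mul (by positivity)] at h1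
    exact (ENNReal.ofReal_le_ofReal_iff (by positivity)).1 h1
  have hlim : Tendsto (fun r : ℝ => (cConst p * a ^ p) ^ 2 * r ^ (2 * p) * k ^ 2) (𝓝[>] 1)
      (𝓝 ((cConst p * a ^ p) ^ 2 * 1 ^ (2 * p) * k ^ 2)) := by
    refine Tendsto.mono_left ?_ nhdsWithin_le_nhds
    exact ((Real.continuousAt_rpow_const 1 (2 * p) (Or.inl one_ne_zero)).tendsto.const_mul
      _).mul_const _
  have h2 := ge_of_tendsto hlim (eventually_nhdsWithin_of_forall fun r hr => key r hr)
  rw [Real.one_rpow, mul_one] at h2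
  refine le_of_sq_le_sq ?_ (by positivity)
  linarith

end IsResolutionOf

end ResolutionOfIdentity

/-! ### Error bounds -/

variable {A : H →ₗ.[𝕜] H} {a : ℝ}

theorem IsTikhonov.norm_sub_le {B : H →L[𝕜] H} (hB : IsTikhonov A a B)
    (hdense : Dense (A.domain : Set H)) {p k δ : ℝ} (hp0 : 0 < p) (hp1 : p < 1) (hk : 0 < k)
    (ha : 0 < a) {f v : H} (hv : v ∈ admissible A (sourceSet A p k) f δ) :
    ‖B f - v‖ ≤ errorBound p k δ a := by
  -- The bias estimate holds for every resolution of `T`, so whichever one witnesses membership will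
  -- do; uniqueness is not needed.
  obtain ⟨⟨E, hE, hy⟩, hvA, hδ⟩ := hv
  obtain ⟨hw, e⟩ := hB.opT_sub hdense hvA
  have h1 := hE.norm_le_of_lintegral_le (opT_nonneg hdense) hp0 hp1 ha hk hy ⟨_, hw⟩ e
  have h2 := hB.norm_le ha (f - A ⟨v, hvA⟩)
  rw [norm_sub_rev] at hδ
  calc ‖B f - v‖ = ‖B (f - A ⟨v, hvA⟩) - (v - B (A ⟨v, hvA⟩))‖ := by
        congr 1
        rw [map_sub]
        abel
    _ ≤ ‖B (f - A ⟨v, hvA⟩)‖ + ‖v - B (A ⟨v, hvA⟩)‖ := _root_.norm_sub_le _ _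
    _ ≤ δ / (2 * √a) + cConst p * k * a ^ p := by
        refine add_le_add (h2.trans ?_) h1
        gcongr

theorem regOp_domain_eq_top (hclosed : A.IsClosed) (hdense : Dense (A.domain : Set H))
    (ha : 0 < a) : (regOp A a).domain = ⊤ := by
  obtain ⟨B, hB⟩ := exists_isTikhonov hclosed ha
  exact Submodule.eq_top_iff'.2 fun f =>
    LinearPMap.mem_domain_of_mem_graph (hB.mem_graph_regOp hclosed hdense ha f)

theorem worstError_regOp_le (hclosed : A.IsClosed) (hdense : Dense (A.domain : Set H))
    {p k : ℝ} (hp0 : 0 < p) (hp1 : p < 1) (hk : 0 < k) (ha : 0 < a) (δ : ℝ) (f : H) :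
    ∃ hf : f ∈ (regOp A a).domain,
      worstError (admissible A (sourceSet A p k) f δ) (regOp A a ⟨f, hf⟩) ≤
        ENNReal.ofReal (errorBound p k δ a) := by
  obtain ⟨B, hB⟩ := exists_isTikhonov hclosed ha
  refine ⟨by rw [regOp_domain_eq_top hclosed hdense ha]; trivial, ?_⟩
  rw [hB.regOp_eq hclosed hdense ha]
  exact iSup₂_le fun v hv =>
    ENNReal.ofReal_le_ofReal (hB.norm_sub_le hdense hp0 hp1 hk ha hv)

end IllPosed

end

theorem theorem2p1 {𝕜 H : Type*} [RCLike 𝕜] [NormedAddCommGroup H] [InnerProductSpace 𝕜 H]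
    [CompleteSpace H] (A : H →ₗ.[𝕜] H) (hclosed : A.IsClosed)
    (hdense : Dense (A.domain : Set H)) (p k : ℝ) (hp0 : 0 < p) (hp1 : p < 1) (hk : 0 < k) :
    -- `T_a⁻¹ A*` is closable and its closure is defined on all of `H`
    (∀ a : ℝ, 0 < a →
      (IllPosed.preRegOp A a).IsClosable ∧ (IllPosed.regOp A a).domain = ⊤) ∧
    -- `R_δ` is a regularizer
    (∀ a : ℝ → ℝ, (∀ δ, 0 < δ → 0 < a δ) →
      Tendsto (fun δ => δ / a δ ^ (1 / 2 : ℝ)) (𝓝[>] 0) (𝓝 0) →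
      Tendsto a (𝓝[>] 0) (𝓝 0) →
      IllPosed.IsUniformRegularizer A (IllPosed.sourceSet A p k)
        (fun δ => IllPosed.regOp A (a δ))) ∧
    -- the rate for `a(δ) = b_p δ^(2/(2p+1))`
    (∀ δ : ℝ, 0 < δ → ∀ f : H, ∃ hf : f ∈ (IllPosed.regOp A (IllPosed.aOpt p k δ)).domain,
      IllPosed.worstError (IllPosed.admissible A (IllPosed.sourceSet A p k) f δ)
          (IllPosed.regOp A (IllPosed.aOpt p k δ) ⟨f, hf⟩)
        ≤ ENNReal.ofReal (IllPosed.CConst p k * δ ^ (2 * p / (2 * p + 1)))) ∧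
    -- the error bound for an arbitrary `a > 0`
    (∀ δ : ℝ, 0 < δ → ∀ a : ℝ, 0 < a → ∀ f : H, ∃ hf : f ∈ (IllPosed.regOp A a).domain,
      IllPosed.worstError (IllPosed.admissible A (IllPosed.sourceSet A p k) f δ)
          (IllPosed.regOp A a ⟨f, hf⟩)
        ≤ ENNReal.ofReal (IllPosed.errorBound p k δ a)) ∧
    -- this `a(δ)` minimises the error bound over `a > 0`
    (∀ δ : ℝ, 0 < δ → 0 < IllPosed.aOpt p k δ ∧
      ∀ a : ℝ, 0 < a →
        IllPosed.errorBound p k δ (IllPosed.aOpt p k δ) ≤ IllPosed.errorBound p k δ a) := by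
  refine ⟨fun a ha => ?_, fun a ha h1 h2 => ?_, fun δ hδ f => ?_, fun δ _ a ha f => ?_,
    fun δ hδ => ⟨IllPosed.aOpt_pos hp0 hp1 hk hδ, fun a ha =>
      IllPosed.errorBound_aOpt_le hp0 hp1 hk hδ ha⟩⟩
  · obtain ⟨B, hB⟩ := IllPosed.exists_isTikhonov hclosed ha
    exact ⟨hB.isClosable_preRegOp hdense ha, IllPosed.regOp_domain_eq_top hclosed hdense ha⟩
  · exact ⟨fun δ => IllPosed.errorBound p k δ (a δ), IllPosed.tendsto_errorBound hp0 h1 h2,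
      fun δ hδ f => IllPosed.worstError_regOp_le hclosed hdense hp0 hp1 hk (ha δ hδ) δ f⟩
  · rw [← IllPosed.errorBound_aOpt hp0 hp1 hk hδ]
    exact IllPosed.worstError_regOp_le hclosed hdense hp0 hp1 hk
      (IllPosed.aOpt_pos hp0 hp1 hk hδ) δ f
  · exact IllPosed.worstError_regOp_le hclosed hdense hp0 hp1 hk ha δ f
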